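/- Let $\Gamma=(V,E)$ be a connected finite simple graph with $|V|=r+1\ge 3$ and $|E|=n\ge 3$, and let $F_\Gamma=\sum_T\prod_{e\in T}x_e\in\mathbb R[x_e : e\in E]$ be its Kirchhoff polynomial, where $T$ runs over the (edge sets of the) spanning trees of $\Gamma$. Put $$\mathrm{Ann}(F_\Gamma)=\{P : P(\partial/\partial x)\,F_\Gamma=0\},\qquad R_\Gamma=\mathbb R[x_e : e\in E]/\mathrm{Ann}(F_\Gamma),$$ where $P(\partial/\partial x)$ is the differential operator obtained by substituting $\partial/\partial x_e$ for each $x_e$, and let $R_\Gamma^\ell\subseteq R_\Gamma$ be the space of classes of homogeneous polynomials of degree $\ell$. Let $[-]:R_\Gamma^r\to\mathbb R$ be the linear map that sends the class of $P$ to the constant $P(\partial/\partial x)F_\Gamma$. For $a\in(\mathbb R_{>0})^E$ let $L_a=\sum_{e\in E}a_ex_e\in R_\Gamma^1$ and let $$Q:R_\Gamma^1\times R_\Gamma^1\to\mathbb R,\qquad Q(\xi_1,\xi_2)=[\xi_1L_a^{r-2}\xi_2]$$ be the Hodge–Riemann form. Then $[-]$ is an isomorphism and, for every $a\in(\mathbb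 R_{>0})^E$, the form $Q$ is nondegenerate; moreover $\dim_{\mathbb R}R_\Gamma^1=n$ and $Q$ has $n-1$ negative eigenvalues and one positive eigenvalue, counted with multiplicity (that is, in every basis of $R_\Gamma^1$ the Gram matrix of $Q$ is symmetric and has $n-1$ negative eigenvalues and one positive eigenvalue). Also, $L_a$ satisfies the Hodge–Riemann relation in degree one: $Q(\xi,\xi)<0$ for every nonzero $\xi\in R_\Gamma^1$ with $L_a^{r-1}\xi=0$. -/

import Mathlib

open MvPolynomial

noncomputable section

namespace HodgeRiemannGraph

/-- A set `T` of edges of `G` is (the edge set of) a spanning tree of `G` if the graph on all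
the vertices of `G` whose edges are the members of `T` is a tree. -/
def IsSpanningTree {V : Type*} (G : SimpleGraph V) (T : Finset G.edgeSet) : Prop :=
  (SimpleGraph.fromEdgeSet {e : Sym2 V | ∃ t ∈ T, (t : Sym2 V) = e}).IsTree

open Classical in
/-- The Kirchhoff polynomial `∑_T ∏_{e ∈ T} x_e`, where `T` runs over the spanning trees. The
variables are indexed by the edges of the graph. -/
def kirchhoff {V : Type*} (G : SimpleGraph V) [Fintype G.edgeSet] : MvPolynomial G.edgeSet ℝ :=
  ∑ T : Finset G.edgeSet with IsSpanningTree G T, ∏ e ∈ T, X e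

section Algebra

variable {σ : Type*}

/-- The partial derivative `∂/∂x_i` as a linear endomorphism of the polynomial ring. -/
def partialEnd (i : σ) : Module.End ℝ (MvPolynomial σ ℝ) := (pderiv i).toLinearMap

theorem partialEnd_comm (i j : σ) :
    partialEnd i * partialEnd j = partialEnd j * partialEnd i := by
  have h : ⁅pderiv (R := ℝ) i, pderiv (R := ℝ) j⁆ = 0 := by
    classical
    refine MvPolynomial.derivation_ext fun k => ?_
    by_cases hj : k = j <;> by_cases hi : k = i <;>
      simp [Derivation.commutator_apply, pderiv_X, Pi.single_apply, hi, hj] <;>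
      split_ifs <;> simp
  refine LinearMap.ext fun p => ?_
  have := DFunLike.congr_fun h p
  simpa [Derivation.commutator_apply, sub_eq_zero, partialEnd] using this

open scoped IsMulCommutative in
/-- The algebra homomorphism `P ↦ P(∂/∂x_1, …, ∂/∂x_n)` from polynomials to linear endomorphisms
of the polynomial ring: evaluation of `P` at the partial derivatives, inside the commutative
subalgebra of endomorphisms that the partial derivatives generate. -/
def diffOp : MvPolynomial σ ℝ →ₐ[ℝ] Module.End ℝ (MvPolynomial σ ℝ) :=
  haveI : IsMulCommutative (Algebra.adjoin ℝ (Set.range (partialEnd (σ := σ)))) :=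
    Algebra.isMulCommutative_adjoin ℝ (by
      rintro _ ⟨i, rfl⟩ _ ⟨j, rfl⟩
      exact partialEnd_comm i j)
  (Algebra.adjoin ℝ (Set.range (partialEnd (σ := σ)))).val.comp
    (aeval fun i : σ => (⟨partialEnd i, Algebra.subset_adjoin ⟨i, rfl⟩⟩ :
      Algebra.adjoin ℝ (Set.range (partialEnd (σ := σ)))))

@[simp]
theorem diffOp_X (i : σ) : diffOp (X i : MvPolynomial σ ℝ) = partialEnd i := by
  simp [diffOp]

@[simp]
theorem partialEnd_apply (i : σ) (p : MvPolynomial σ ℝ) : partialEnd i p = pderiv i p := rfl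

/-- The ideal `Ann(F) = {P | P(∂/∂x_1, …, ∂/∂x_n) F = 0}`. -/
def annIdeal (F : MvPolynomial σ ℝ) : Ideal (MvPolynomial σ ℝ) where
  carrier := {P | diffOp P F = 0}
  add_mem' {P Q} hP hQ := by
    simp only [Set.mem_ofPred_eq] at hP hQ ⊢
    simp [hP, hQ]
  zero_mem' := by simp
  smul_mem' P Q hQ := by
    simp only [Set.mem_ofPred_eq] at hQ ⊢
    simp [hQ]

/-- The algebra `R_F = ℝ[x_1, …, x_n] / Ann(F)`. -/
abbrev GorensteinAlgebra (F : MvPolynomial σ ℝ) : Type _ := MvPolynomial σ ℝ ⧸ annIdeal F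

/-- The homogeneous component `R_F^ℓ` of `R_F`: the classes of the homogeneous polynomials of
degree `ℓ`. -/
def gradedPiece (F : MvPolynomial σ ℝ) (l : ℕ) : Submodule ℝ (GorensteinAlgebra F) :=
  (homogeneousSubmodule σ ℝ l).map (Ideal.Quotient.mkₐ ℝ (annIdeal F)).toLinearMap

/-- The well-defined linear map `R_F → ℝ[x_1, …, x_n]`, `[P] ↦ P(∂/∂x_1, …, ∂/∂x_n) F`. -/
def applyTo (F : MvPolynomial σ ℝ) : GorensteinAlgebra F →ₗ[ℝ] MvPolynomial σ ℝ :=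
  ((annIdeal F).restrictScalars ℝ).liftQ (diffOp.toLinearMap.flip F) fun _ hP => hP

@[simp]
theorem applyTo_mk (F P : MvPolynomial σ ℝ) :
    applyTo F (Ideal.Quotient.mk (annIdeal F) P) = diffOp P F := rfl

/-- The map `[-]`, which sends the class of `P` to `P(∂/∂x_1, …, ∂/∂x_n) F`. For `F` homogeneous
of degree `r` it is meant for classes in `R_F^r`, and there `P(∂/∂x_1, …, ∂/∂x_n) F` is a
constant polynomial (see `C_bracket`), which is read as a real number by taking its constant
coefficient. -/
def bracket (F : MvPolynomial σ ℝ) : GorensteinAlgebra F →ₗ[ℝ] ℝ :=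
  (lcoeff ℝ (0 : σ →₀ ℕ)).comp (applyTo F)

theorem diffOp_monomial_isHomogeneous (m : σ →₀ ℕ) : ∀ (c : ℝ) (F : MvPolynomial σ ℝ) (k : ℕ),
    F.IsHomogeneous (m.degree + k) → (diffOp (monomial m c) F).IsHomogeneous k := by
  induction m using Finsupp.induction_linear with
  | zero =>
    intro c F k hF
    have : diffOp (monomial (0 : σ →₀ ℕ) c) F = C c * F := by
      rw [← C_apply, ← algebraMap_eq, AlgHom.commutes]
      simp [Module.algebraMap_end_apply, MvPolynomial.smul_eq_C_mul]
    rw [this]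
    simpa using hF.C_mul c
  | add m n hm hn =>
    intro c F k hF
    have : monomial (m + n) c = monomial m c * monomial n 1 := by simp [monomial_mul]
    rw [this, map_mul, Module.End.mul_apply]
    refine hm c _ k (hn 1 _ _ ?_)
    rw [map_add] at hF
    convert hF using 1
    ring
  | single i j =>
    induction j with
    | zero =>
      intro c F k hF
      have : diffOp (monomial (Finsupp.single i 0) c) F = C c * F := by
        rw [Finsupp.single_zero, ← C_apply, ← algebraMap_eq, AlgHom.commutes]
        simp [Module.algebraMap_end_apply, MvPolynomial.smul_eq_C_mul]
      rw [this]
      simpa using hF.C_mul c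
    | succ j ih =>
      intro c F k hF
      have : monomial (Finsupp.single i (j + 1)) c = monomial (Finsupp.single i j) c * X i := by
        rw [X, monomial_mul, ← Finsupp.single_add, mul_one]
      rw [this, map_mul, Module.End.mul_apply, diffOp_X, partialEnd_apply]
      refine ih c _ k ?_
      have h := hF.pderiv (i := i)
      convert h using 1
      simp only [Finsupp.degree_single]
      omega

/-- On `R_F^r`, with `F` homogeneous of degree `r`, the value `P(∂/∂x_1, …, ∂/∂x_n) F` is the
constant polynomial with value `[P]`. -/
theorem C_bracket {F : MvPolynomial σ ℝ} {r : ℕ} (hF : F.IsHomogeneous r)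
    {ξ : GorensteinAlgebra F} (hξ : ξ ∈ gradedPiece F r) : C (bracket F ξ) = applyTo F ξ := by
  obtain ⟨P, hP, rfl⟩ := hξ
  have key : (diffOp P F).IsHomogeneous 0 := by
    rw [P.as_sum, map_sum, LinearMap.sum_apply]
    refine IsHomogeneous.sum _ _ _ fun m hm => diffOp_monomial_isHomogeneous m _ F 0 ?_
    have hm' : m.degree = r := by
      have := hP (mem_support_iff.mp hm)
      rw [← this, Finsupp.degree_eq_weight_one]
      rfl
    rwa [hm', add_zero]
  rw [← totalDegree_zero_iff_isHomogeneous, totalDegree_eq_zero_iff_eq_C] at key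
  exact key.symm

/-- The element `L_a = a_1 x_1 + ⋯ + a_n x_n` of `R_F^1`. -/
def linearElement [Fintype σ] (F : MvPolynomial σ ℝ) (a : σ → ℝ) : gradedPiece F 1 :=
  ⟨Ideal.Quotient.mk (annIdeal F) (∑ i, C (a i) * X i),
    ⟨_, IsHomogeneous.sum _ _ _ fun i _ => (isHomogeneous_X ℝ i).C_mul (a i), rfl⟩⟩

/-- The Hodge–Riemann bilinear form `Q(ξ₁, ξ₂) = [ξ₁ L^(r-2) ξ₂]` on `R_F^1`, for `F` homogeneous
of degree `r ≥ 2` and `L ∈ R_F^1`. -/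
def hodgeRiemannForm (F : MvPolynomial σ ℝ) (r : ℕ) (L : gradedPiece F 1) :
    LinearMap.BilinForm ℝ (gradedPiece F 1) :=
  LinearMap.mk₂ ℝ
    (fun ξ₁ ξ₂ => bracket F ((ξ₁ : GorensteinAlgebra F) * (L : GorensteinAlgebra F) ^ (r - 2) * ξ₂))
    (by intros; simp [add_mul])
    (by intros; simp only [Submodule.coe_smul, smul_mul_assoc, map_smul])
    (by intros; simp [mul_add])
    (by intros; simp only [Submodule.coe_smul, mul_smul_comm, map_smul])

/-- `L ∈ R_F^1` satisfies the Hodge–Riemann relation in degree one, for `F` homogeneous of degree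
`r ≥ 2`: the Hodge–Riemann form is negative definite on the kernel of the multiplication by
`L^(r-1)` on `R_F^1`. -/
def HodgeRiemannRelation (F : MvPolynomial σ ℝ) (r : ℕ) (L : gradedPiece F 1) : Prop :=
  ∀ ξ : gradedPiece F 1, (L : GorensteinAlgebra F) ^ (r - 1) * (ξ : GorensteinAlgebra F) = 0 →
    ξ ≠ 0 → hodgeRiemannForm F r L ξ ξ < 0

end Algebra

end HodgeRiemannGraph

end

open HodgeRiemannGraph

/-! By the matrix-tree theorem `F = kirchhoff G` is the determinant of the reduced weighted
Laplacian `M(x) = ∑ x_e b_e b_eᵀ`, which is linear in `x`. For positive `a` the matrix `M(a)` is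
positive definite, so it can be diagonalized together with any `M(u)`, giving `F(a + t u) = F(a) ∏
(1 + t μ_i)` with real `μ_i`. If `u ≠ 0`, then `M(u) ≠ 0` and some `μ_i` is nonzero.

Euler's identity turns powers of `L_a` into evaluation at `a`, so derivatives at `t = 0` give
`Q(L_a, L_u) = (r-2)! (r-1) F(a) ∑ μ_i` and `Q(L_u, L_u) = (r-2)! F(a) ((∑ μ_i)² - ∑ μ_i²)`. Hence
`Q(L_a, L_u) = 0` forces `Q(L_u, L_u) < 0` when `u ≠ 0`, while `Q(L_a, L_a) > 0`. This Lorentzian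
property gives the Hodge–Riemann relation, the nondegeneracy and the inertia. It also gives the
dimension: `L_u = 0` with `u ≠ 0` would make `0 < 0`. The key lemmas are
`det_weightedGram_reducedEdgeVec`, `exists_eval_line_kirchhoff` and
`hodgeRiemannForm_kirchhoff_neg`. -/

/-! ### Inertia of Lorentzian matrices and simultaneous diagonalization. -/

section LinearAlgebra

open Matrix

variable {ι : Type*} [Fintype ι] [DecidableEq ι]

/-- The inertia of a symmetric matrix which is positive at some vector `l` and negative definite on
the orthogonal complement of `l`. -/
theorem Matrix.IsHermitian.card_eigenvalues_of_lorentzian {A : Matrix ι ι ℝ} (hA : A.IsHermitian)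
    (l : ι → ℝ) (hl : 0 < l ⬝ᵥ A *ᵥ l)
    (hneg : ∀ x : ι → ℝ, x ≠ 0 → l ⬝ᵥ A *ᵥ x = 0 → x ⬝ᵥ A *ᵥ x < 0) :
    Fintype.card {i // hA.eigenvalues i < 0} = Fintype.card ι - 1 ∧
      Fintype.card {i // 0 < hA.eigenvalues i} = 1 := by
  classical
  set v : ι → ι → ℝ := fun i => (hA.eigenvectorBasis i).ofLp with hv
  have hAv : ∀ i, A *ᵥ v i = hA.eigenvalues i • v i := fun i => hA.mulVec_eigenvectorBasis i
  have horth : ∀ i j, v i ⬝ᵥ v j = if i = j then 1 else 0 := by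
    intro i j
    have := orthonormal_iff_ite.mp hA.eigenvectorBasis.orthonormal j i
    simp only [EuclideanSpace.inner_eq_star_dotProduct, star_trivial] at this
    rw [hv, this]
    simp [eq_comm]
  have hv0 : ∀ i, v i ≠ 0 := by
    intro i h
    have := horth i i
    simp [h] at this
  have hne : ∀ i, hA.eigenvalues i ≠ 0 := by
    intro i h
    have h0 : A *ᵥ v i = 0 := by rw [hAv, h, zero_smul]
    have := hneg (v i) (hv0 i) (by simp [h0])
    simp [h0] at this
  have hexp : l ⬝ᵥ A *ᵥ l = ∑ i, hA.eigenvalues i * (v i ⬝ᵥ l) ^ 2 := by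
    have h := hA.eigenvectorBasis.sum_inner_mul_inner (WithLp.toLp 2 l) (WithLp.toLp 2 (A *ᵥ l))
    simp only [EuclideanSpace.inner_eq_star_dotProduct, star_trivial] at h
    rw [dotProduct_comm, ← h]
    refine Finset.sum_congr rfl fun i _ => ?_
    have : A *ᵥ l ⬝ᵥ v i = hA.eigenvalues i * (v i ⬝ᵥ l) := by
      rw [dotProduct_comm, dotProduct_mulVec, ← mulVec_transpose,
        show Aᵀ = A from by simpa [conjTranspose] using hA.eq, hAv, smul_dotProduct, smul_eq_mul]
    simp only [hv] at this ⊢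
    rw [this]
    ring
  have hexists : ∃ i, 0 < hA.eigenvalues i := by
    by_contra! hcon
    have : l ⬝ᵥ A *ᵥ l ≤ 0 := by
      rw [hexp]
      exact Finset.sum_nonpos fun i _ => mul_nonpos_of_nonpos_of_nonneg (hcon i) (sq_nonneg _)
    linarith
  -- Two positive eigenvectors would span a plane on which the form is positive definite, yet every
  -- plane meets the orthogonal complement of `l`.
  have hunique : ∀ i j, 0 < hA.eigenvalues i → 0 < hA.eigenvalues j → i = j := by
    intro i j hi hj
    by_contra hij
    have hpos : ∀ s t : ℝ, (s ≠ 0 ∨ t ≠ 0) →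
        l ⬝ᵥ A *ᵥ (s • v i + t • v j) = 0 → False := by
      intro s t hst h0
      have e : (s • v i + t • v j) ⬝ᵥ A *ᵥ (s • v i + t • v j) =
          s ^ 2 * hA.eigenvalues i + t ^ 2 * hA.eigenvalues j := by
        simp only [mulVec_add, mulVec_smul, hAv, add_dotProduct, dotProduct_add, smul_dotProduct,
          dotProduct_smul, horth, smul_eq_mul, if_neg hij, if_neg (Ne.symm hij), if_true]
        ring
      have hp : 0 < s ^ 2 * hA.eigenvalues i + t ^ 2 * hA.eigenvalues j := by
        rcases hst with h | h <;> positivity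
      have hx : s • v i + t • v j ≠ 0 := by
        intro h
        rw [h] at e
        simp at e
        linarith
      linarith [hneg _ hx h0]
    by_cases h : l ⬝ᵥ A *ᵥ v j = 0
    · exact hpos 0 1 (Or.inr one_ne_zero) (by simpa using h)
    · refine hpos (l ⬝ᵥ A *ᵥ v j) (-(l ⬝ᵥ A *ᵥ v i)) (Or.inl h) ?_
      simp only [mulVec_add, mulVec_smul, dotProduct_add, dotProduct_smul, smul_eq_mul]
      ring
  obtain ⟨i₀, hi₀⟩ := hexists
  have hone : Fintype.card {i // 0 < hA.eigenvalues i} = 1 :=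
    Fintype.card_eq_one_iff.mpr ⟨⟨i₀, hi₀⟩, fun ⟨j, hj⟩ => Subtype.ext (hunique j i₀ hj hi₀)⟩
  refine ⟨?_, hone⟩
  have hcompl := Fintype.card_subtype_compl fun i => 0 < hA.eigenvalues i
  rw [hone] at hcompl
  rw [← hcompl]
  exact Fintype.card_congr (Equiv.subtypeEquivRight fun i =>
    ⟨fun h => not_lt.mpr h.le, fun h => lt_of_le_of_ne (not_lt.mp h) (hne i)⟩)

/-- A real symmetric matrix can be diagonalized relatively to a positive definite one. -/
theorem Matrix.PosDef.exists_det_add_smul_eq {A H : Matrix ι ι ℝ} (hA : A.PosDef)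
    (hH : H.IsHermitian) :
    ∃ μ : ι → ℝ, (∀ t : ℝ, (A + t • H).det = A.det * ∏ i, (1 + t * μ i)) ∧ (μ = 0 → H = 0) := by
  obtain ⟨B, hB, rfl⟩ : ∃ B : Matrix ι ι ℝ, IsUnit B ∧ A = Bᴴ * B := by
    open scoped MatrixOrder in
    obtain ⟨B, rfl⟩ := CStarAlgebra.nonneg_iff_eq_star_mul_self.mp hA.posSemidef.nonneg
    refine ⟨B, ?_, rfl⟩
    have := hA.isUnit
    rw [isUnit_iff_isUnit_det, det_mul] at this
    rw [isUnit_iff_isUnit_det]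
    exact isUnit_of_mul_isUnit_right this
  obtain ⟨C, hBC, hCB⟩ : ∃ C : Matrix ι ι ℝ, B * C = 1 ∧ C * B = 1 := by
    obtain ⟨u, rfl⟩ := hB
    exact ⟨↑u⁻¹, u.mul_inv, u.inv_mul⟩
  have hM : (Cᴴ * H * C).IsHermitian := isHermitian_conjTranspose_mul_mul C hH
  have hH' : H = Bᴴ * (Cᴴ * H * C) * B := by
    have : Bᴴ * (Cᴴ * H * C) * B = (C * B)ᴴ * H * (C * B) := by
      simp only [conjTranspose_mul, Matrix.mul_assoc]
    rw [this, hCB]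
    simp
  refine ⟨hM.eigenvalues, fun t => ?_, fun h => ?_⟩
  · set M := Cᴴ * H * C
    -- Congruence by `B` turns the positive definite matrix into the identity, so the `μ i` are the
    -- eigenvalues of `M`.
    have e : Bᴴ * B + t • H = Bᴴ * (1 + t • M) * B := by
      conv_lhs => rw [hH']
      simp [Matrix.mul_add, Matrix.add_mul]
    have hdet : (1 + t • M).det = ∏ i, (1 + t * hM.eigenvalues i) := by
      set U : Matrix ι ι ℝ := (hM.eigenvectorUnitary : Matrix ι ι ℝ)
      have hU : U * star U = 1 := Unitary.coe_mul_star_self hM.eigenvectorUnitary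
      have hs : M = U * diagonal hM.eigenvalues * star U := by
        simpa [Unitary.conjStarAlgAut_apply] using hM.spectral_theorem
      have : 1 + t • M = U * diagonal (fun i => 1 + t * hM.eigenvalues i) * star U := by
        conv_lhs => rw [hs, ← hU]
        rw [show diagonal (fun i => 1 + t * hM.eigenvalues i) =
          1 + t • diagonal hM.eigenvalues by
            rw [← diagonal_one, ← diagonal_smul, diagonal_add]; rfl]
        simp [Matrix.mul_add, Matrix.add_mul]
      rw [this, det_mul_right_comm, hU, one_mul, det_diagonal]
    rw [e, det_mul, det_mul, hdet, det_mul]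
    ring
  · have : Cᴴ * H * C = 0 := hM.eigenvalues_eq_zero_iff.mp h
    rw [hH', this]
    simp

end LinearAlgebra

/-! ### Differential operators of linear forms and restriction to lines. -/

section DirectionalDerivative

variable {σ : Type*}

/-- The restriction of a polynomial to the line through `a` with direction `u`. -/
noncomputable def restrictLine (a u : σ → ℝ) : MvPolynomial σ ℝ →ₐ[ℝ] Polynomial ℝ :=
  aeval fun i => Polynomial.C (a i) + Polynomial.C (u i) * Polynomial.X

theorem eval_restrictLine (a u : σ → ℝ) (F : MvPolynomial σ ℝ) (t : ℝ) :
    (restrictLine a u F).eval t = eval (a + t • u) F := by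
  induction F using MvPolynomial.induction_on with
  | C c => simp [restrictLine]
  | add p q hp hq => simp [hp, hq]
  | mul_X p i hp =>
    rw [map_mul, Polynomial.eval_mul, hp, map_mul]
    simp [restrictLine, mul_comm _ (u i)]

variable [Fintype σ]

theorem diffOp_C_mul_X_sum (u : σ → ℝ) (F : MvPolynomial σ ℝ) :
    diffOp (∑ i, C (u i) * X i) F = ∑ i, C (u i) * pderiv i F := by
  rw [map_sum, LinearMap.sum_apply]
  refine Finset.sum_congr rfl fun i _ => ?_
  rw [map_mul, Module.End.mul_apply, diffOp_X, partialEnd_apply, ← algebraMap_eq, AlgHom.commutes,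
    Module.algebraMap_end_apply, algebraMap_eq, smul_eq_C_mul]

theorem diffOp_C_mul_X_sum_isHomogeneous (u : σ → ℝ) {F : MvPolynomial σ ℝ} {k : ℕ}
    (hF : F.IsHomogeneous (k + 1)) : (diffOp (∑ i, C (u i) * X i) F).IsHomogeneous k := by
  rw [diffOp_C_mul_X_sum]
  exact IsHomogeneous.sum _ _ _ fun i _ => (hF.pderiv (i := i)).C_mul (u i)

/-- Euler's identity at a point. -/
theorem eval_diffOp_C_mul_X_sum_self (a : σ → ℝ) {F : MvPolynomial σ ℝ} {k : ℕ}
    (hF : F.IsHomogeneous k) : eval a (diffOp (∑ i, C (a i) * X i) F) = k * eval a F := by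
  have := congrArg (eval a) hF.sum_X_mul_pderiv
  simpa [diffOp_C_mul_X_sum] using this

/-- Euler's identity, iterated: each application lowers the degree by one, and the degrees multiply
to `k!`. -/
theorem diffOp_C_mul_X_sum_pow (a : σ → ℝ) {F : MvPolynomial σ ℝ} {k : ℕ}
    (hF : F.IsHomogeneous k) :
    diffOp ((∑ i, C (a i) * X i) ^ k) F = C (k.factorial * eval a F) := by
  induction k generalizing F with
  | zero =>
    rw [← totalDegree_zero_iff_isHomogeneous, totalDegree_eq_zero_iff_eq_C] at hF
    rw [hF]
    simp
  | succ k ih =>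
    rw [pow_succ, map_mul, Module.End.mul_apply, ih (diffOp_C_mul_X_sum_isHomogeneous a hF),
      eval_diffOp_C_mul_X_sum_self a hF, Nat.factorial_succ]
    congr 1
    push_cast
    ring

theorem derivative_restrictLine (a u : σ → ℝ) (F : MvPolynomial σ ℝ) :
    Polynomial.derivative (restrictLine a u F) =
      restrictLine a u (diffOp (∑ i, C (u i) * X i) F) := by
  classical
  simp only [diffOp_C_mul_X_sum]
  induction F using MvPolynomial.induction_on with
  | C c => simp [restrictLine]
  | add p q hp hq => simp [hp, hq, mul_add, Finset.sum_add_distrib]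
  | mul_X p i hp =>
    have hX : restrictLine a u (X i) = Polynomial.C (a i) + Polynomial.C (u i) * Polynomial.X := by
      simp [restrictLine]
    have hC : restrictLine a u (C (u i)) = Polynomial.C (u i) := by simp [restrictLine]
    have : ∑ j, C (u j) * pderiv j (p * X i) =
        (∑ j, C (u j) * pderiv j p) * X i + p * C (u i) := by
      simp only [Derivation.leibniz, pderiv_X, smul_eq_mul, Pi.single_apply, mul_add,
        Finset.sum_add_distrib, mul_ite, mul_one, mul_zero]
      rw [Finset.sum_ite_eq Finset.univ i]
      simp only [Finset.mem_univ, if_true, Finset.sum_mul]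
      rw [add_comm, mul_comm p]
      congr 1
      exact Finset.sum_congr rfl fun j _ => by ring
    rw [this, map_mul, Polynomial.derivative_mul, hp, hX, map_add (restrictLine a u),
      map_mul (restrictLine a u), map_mul (restrictLine a u), hX, hC]
    simp

/-- The coefficients are elementary symmetric functions, and the second derivative is `2 e₂ = e₁² -
p₂`, with `p₂` the sum of squares. -/
theorem Polynomial.eval_zero_prod_one_add {ι : Type*} (s : Finset ι) (μ : ι → ℝ) :
    (∏ i ∈ s, (1 + Polynomial.C (μ i) * Polynomial.X)).eval 0 = 1 ∧
    (Polynomial.derivative (∏ i ∈ s, (1 + Polynomial.C (μ i) * Polynomial.X))).eval 0 =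
      ∑ i ∈ s, μ i ∧
    (Polynomial.derivative (Polynomial.derivative
      (∏ i ∈ s, (1 + Polynomial.C (μ i) * Polynomial.X)))).eval 0 =
      (∑ i ∈ s, μ i) ^ 2 - ∑ i ∈ s, μ i ^ 2 := by
  classical
  induction s using Finset.induction_on with
  | empty => simp
  | insert i s hi ih =>
    obtain ⟨h0, h1, h2⟩ := ih
    rw [Finset.prod_insert hi, Finset.sum_insert hi, Finset.sum_insert hi]
    set P := ∏ i ∈ s, (1 + Polynomial.C (μ i) * Polynomial.X)
    refine ⟨by simp [h0], by simp [h0, h1], ?_⟩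
    simp only [Polynomial.derivative_mul, Polynomial.derivative_add, Polynomial.derivative_one,
      Polynomial.derivative_C, Polynomial.derivative_X, Polynomial.eval_add, Polynomial.eval_mul,
      Polynomial.eval_C, Polynomial.eval_X, Polynomial.eval_one, zero_mul,
      zero_add, mul_one, mul_zero, h1, h2, add_zero, one_mul]
    ring

/-- The first two directional derivatives of a polynomial whose restriction to a line splits into
linear factors. -/
theorem eval_diffOp_of_eval_line_eq_prod {ι : Type*} [Fintype ι] {F : MvPolynomial σ ℝ}
    {a u : σ → ℝ} {c : ℝ} {μ : ι → ℝ} (h : ∀ t : ℝ, eval (a + t • u) F = c * ∏ i, (1 + t * μ i)) :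
    eval a (diffOp (∑ i, C (u i) * X i) F) = c * ∑ i, μ i ∧
    eval a (diffOp (∑ i, C (u i) * X i) (diffOp (∑ i, C (u i) * X i) F)) =
      c * ((∑ i, μ i) ^ 2 - ∑ i, μ i ^ 2) := by
  have key : restrictLine a u F =
      Polynomial.C c * ∏ i, (1 + Polynomial.C (μ i) * Polynomial.X) := by
    refine Polynomial.funext fun t => ?_
    rw [eval_restrictLine, h, Polynomial.eval_mul, Polynomial.eval_prod]
    simp [mul_comm t]
  obtain ⟨-, h1, h2⟩ := Polynomial.eval_zero_prod_one_add Finset.univ μ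
  have hev : ∀ P : MvPolynomial σ ℝ, eval a P = (restrictLine a u P).eval 0 := by
    intro P
    rw [eval_restrictLine]
    simp
  rw [hev, hev, ← derivative_restrictLine, ← derivative_restrictLine, ← derivative_restrictLine, key]
  simp only [Polynomial.derivative_C_mul, Polynomial.eval_C_mul, h1, h2, and_self]

end DirectionalDerivative

/-! ### Determinants of weighted Gram matrices. -/

section CauchyBinet

open Matrix Finset

variable {W E R : Type*} [Fintype E] [CommRing R]

/-- The matrix `∑ x_e b_e b_eᵀ` of a family of vectors `b_e` with weights `x_e`. -/
def weightedGram (b : E → W → R) (x : E → R) : Matrix W W R :=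
  ∑ e, x e • vecMulVec (b e) (b e)

theorem weightedGram_apply (b : E → W → R) (x : E → R) (v w : W) :
    weightedGram b x v w = ∑ e, x e * (b e v * b e w) := by
  simp [weightedGram, Matrix.sum_apply, vecMulVec_apply]

theorem weightedGram_add (b : E → W → R) (x y : E → R) :
    weightedGram b (x + y) = weightedGram b x + weightedGram b y := by
  simp [weightedGram, add_smul, sum_add_distrib]

theorem weightedGram_smul (b : E → W → R) (c : R) (x : E → R) :
    weightedGram b (c • x) = c • weightedGram b x := by
  simp [weightedGram, smul_sum, mul_smul]

theorem weightedGram_mulVec [Fintype W] (b : E → W → R) (x : E → R) (y : W → R) :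
    weightedGram b x *ᵥ y = ∑ e, (x e * (b e ⬝ᵥ y)) • b e := by
  simp only [weightedGram, Matrix.sum_mulVec, smul_mulVec, vecMulVec_mulVec]
  refine sum_congr rfl fun e _ => ?_
  ext v
  simp [mul_comm, mul_left_comm]

theorem weightedGram_indicator_eq [DecidableEq E] (b : E → W → R) (T : Finset E) :
    weightedGram b (fun e => if e ∈ T then 1 else 0) =
      (of fun v (e : T) => b e v) * (of fun v (e : T) => b e v)ᵀ := by
  ext v w
  rw [weightedGram_apply, Matrix.mul_apply]
  simp only [ite_mul, one_mul, zero_mul, transpose_apply, of_apply]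
  rw [← sum_filter, sum_coe_sort T fun e => b e v * b e w]
  simp

theorem weightedGram_map [Fintype W] [DecidableEq W] {S : Type*} [CommRing S] (φ : R →+* S) (b : E → W → R) (x : E → R) :
    φ.mapMatrix (weightedGram b x) = weightedGram (fun e v => φ (b e v)) (fun e => φ (x e)) := by
  ext v w
  simp [weightedGram_apply]

variable [Fintype W] [DecidableEq W]

/-- Row `v` is `∑ x_e b_e(v) b_e`. Expanding multilinearly picks an edge for each row, and a
repeated edge gives two equal rows. -/
theorem det_weightedGram_eq_sum_functions [DecidableEq E] (b : E → W → R) (x : E → R) :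
    (weightedGram b x).det =
      ∑ f : W → E with f.Injective, (∏ v, x (f v)) * ((∏ v, b (f v) v) * (of fun v => b (f v)).det) := by
  have h : weightedGram b x = fun v => ∑ e, (x e * b e v) • b e := by
    ext v w
    rw [weightedGram_apply]
    simp [mul_assoc]
  have hdet : (weightedGram b x).det =
      ∑ f : W → E, (∏ v, x (f v)) * ((∏ v, b (f v) v) * (of fun v => b (f v)).det) := by
    change detRowAlternating (weightedGram b x) = _
    rw [h]
    have := (detRowAlternating (R := R) (n := W)).toMultilinearMap.map_sum
      (fun v e => (x e * b e v) • b e)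
    refine this.trans (sum_congr rfl fun f _ => ?_)
    rw [MultilinearMap.map_smul_univ, prod_mul_distrib, smul_eq_mul, mul_assoc]
    rfl
  rw [hdet, sum_filter_of_ne]
  intro f _ hf
  by_contra hinj
  simp only [Function.Injective, not_forall] at hinj
  obtain ⟨v, w, hvw, hne⟩ := hinj
  refine hf ?_
  rw [det_zero_of_row_eq (M := of fun v => b (f v)) hne (congrArg b hvw), mul_zero, mul_zero]

/-- A form of the Cauchy–Binet formula. -/
theorem det_weightedGram [DecidableEq E] (b : E → W → R) (x : E → R) :
    (weightedGram b x).det = ∑ T ∈ powersetCard (Fintype.card W) univ,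
      (∏ e ∈ T, x e) * (weightedGram b fun e => if e ∈ T then 1 else 0).det := by
  have hmaps : ∀ f ∈ ({f : W → E | f.Injective} : Finset (W → E)),
      univ.image f ∈ powersetCard (Fintype.card W) (univ : Finset E) := by
    intro f hf
    rw [mem_powersetCard_univ, card_image_of_injective _ (by simpa using hf), card_univ]
  rw [det_weightedGram_eq_sum_functions, ← sum_fiberwise_of_maps_to hmaps]
  refine sum_congr rfl fun T hT => ?_
  -- The injections are grouped by image. The indicator weights of `T` kill every image other than
  -- `T`, since all images have the same size.
  rw [det_weightedGram_eq_sum_functions, ← sum_fiberwise_of_maps_to hmaps, sum_eq_single_of_mem T hT,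
    mul_sum]
  · refine sum_congr rfl fun f hf => ?_
    obtain ⟨hinj, rfl⟩ := by simpa using hf
    rw [prod_image fun _ _ _ _ h => hinj h]
    simp
  · intro S hS hST
    refine sum_eq_zero fun f hf => ?_
    obtain ⟨hinj, rfl⟩ := by simpa using hf
    have : ∃ v, f v ∉ T := by
      by_contra! hcon
      refine hST (eq_of_subset_of_card_le ?_ ?_)
      · simpa [subset_iff] using hcon
      · rw [mem_powersetCard_univ] at hS hT
        rw [hS, hT]
    obtain ⟨v, hv⟩ := this
    rw [prod_eq_zero (mem_univ v) (by simp [hv]), zero_mul]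

/-- If an integral square matrix has an integral right inverse, then its Gram determinant is one. -/
theorem det_mul_transpose_eq_one_of_mul_eq_one {T : Type*} [Fintype T] [DecidableEq T]
    (hcard : Fintype.card T = Fintype.card W) (B : Matrix W T ℤ) (D : Matrix T W ℤ)
    (h : B * D = 1) : (B * Bᵀ).det = 1 := by
  let ε : W ≃ T := Fintype.equivOfCardEq hcard.symm
  have h1 : B * Bᵀ = B.submatrix id ε * (B.submatrix id ε)ᵀ := by
    rw [transpose_submatrix, submatrix_mul_equiv]
    simp
  have h2 : B.submatrix id ε * D.submatrix ε id = 1 := by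
    rw [submatrix_mul_equiv, h]
    simp
  -- The determinant is a unit of `ℤ`, hence `±1`, and its square is `1`.
  have h3 : IsUnit (B.submatrix id ε).det := by
    refine IsUnit.of_mul_eq_one (D.submatrix ε id).det ?_
    rw [← det_mul, h2, det_one]
  rw [h1, det_mul, det_transpose]
  rcases Int.isUnit_iff.mp h3 with h | h <;> simp [h]

end CauchyBinet

/-! ### Incidence vectors, spanning trees and the matrix-tree theorem. -/

section Laplacian

open Matrix Finset

variable {V : Type*} (G : SimpleGraph V)

theorem mk_out_edge (e : G.edgeSet) :
    s((Quot.out (e : Sym2 V)).1, (Quot.out (e : Sym2 V)).2) = (e : Sym2 V) :=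
  Quot.out_eq (e : Sym2 V)

/-- The graph on all the vertices with a given set of edges. -/
abbrev edgeSubgraph (T : Finset G.edgeSet) : SimpleGraph V :=
  SimpleGraph.fromEdgeSet {e : Sym2 V | ∃ t ∈ T, (t : Sym2 V) = e}

theorem edgeSet_edgeSubgraph (T : Finset G.edgeSet) :
    (edgeSubgraph G T).edgeSet = {e : Sym2 V | ∃ t ∈ T, (t : Sym2 V) = e} := by
  rw [edgeSubgraph, SimpleGraph.edgeSet_fromEdgeSet]
  refine sdiff_eq_left.mpr ?_
  rw [Set.disjoint_left]
  rintro e ⟨t, ht, rfl⟩ he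
  exact G.not_isDiag_of_mem_edgeSet t.2 (by simpa using he)

theorem natCard_edgeSet_edgeSubgraph (T : Finset G.edgeSet) :
    Nat.card (edgeSubgraph G T).edgeSet = T.card := by
  have : {e : Sym2 V | ∃ t ∈ T, (t : Sym2 V) = e} = Subtype.val '' (T : Set G.edgeSet) := by
    ext e
    simp
  rw [edgeSet_edgeSubgraph, this, Nat.card_coe_set_eq,
    Set.ncard_image_of_injective _ Subtype.val_injective, Set.ncard_coe_finset]

theorem isSpanningTree_iff [Fintype V] (T : Finset G.edgeSet) :
    IsSpanningTree G T ↔ (edgeSubgraph G T).Connected ∧ T.card + 1 = Fintype.card V := by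
  rw [IsSpanningTree, SimpleGraph.isTree_iff_connected_and_card, natCard_edgeSet_edgeSubgraph,
    Nat.card_eq_fintype_card]

theorem exists_isSpanningTree [Fintype G.edgeSet] (hG : G.Connected) : ∃ T : Finset G.edgeSet, IsSpanningTree G T := by
  classical
  obtain ⟨H, hle, hH⟩ := hG.exists_isTree_le
  refine ⟨({e | (e : Sym2 V) ∈ H.edgeSet} : Finset G.edgeSet), ?_⟩
  rw [IsSpanningTree]
  convert! hH
  rw [← SimpleGraph.edgeSet_inj, edgeSet_edgeSubgraph]
  ext e
  simp only [mem_filter, mem_univ, true_and, Subtype.exists, Set.mem_ofPred]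
  exact ⟨by rintro ⟨e, -, h, rfl⟩; exact h,
    fun h => ⟨e, SimpleGraph.edgeSet_mono hle h, h, rfl⟩⟩

variable [DecidableEq V]

/-- The signed incidence vector of an edge, for an arbitrary orientation. -/
noncomputable def edgeVec (e : G.edgeSet) : V → ℤ :=
  Pi.single (Quot.out (e : Sym2 V)).1 1 - Pi.single (Quot.out (e : Sym2 V)).2 1

theorem edgeVec_eq_or {e : G.edgeSet} {v w : V} (h : (e : Sym2 V) = s(v, w)) :
    edgeVec G e = Pi.single v 1 - Pi.single w 1 ∨ edgeVec G e = Pi.single w 1 - Pi.single v 1 := by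
  have h' := (mk_out_edge G e).trans h
  rw [Sym2.eq_iff] at h'
  rcases h' with ⟨h1, h2⟩ | ⟨h1, h2⟩
  · left; rw [edgeVec, h1, h2]
  · right; rw [edgeVec, h1, h2]

/-- The difference telescopes along a walk. Working over `ℤ` is what later makes the incidence
matrix of a tree unimodular. -/
theorem single_sub_single_mem_span (T : Finset G.edgeSet) {v w : V}
    (h : (edgeSubgraph G T).Reachable v w) :
    (Pi.single v 1 - Pi.single w 1 : V → ℤ) ∈
      Submodule.span ℤ (Set.range fun e : T => edgeVec G e) := by
  obtain ⟨p⟩ := h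
  induction p with
  | nil => simp
  | @cons u v w huv p ih =>
    rw [← sub_add_sub_cancel _ (Pi.single v 1)]
    refine add_mem ?_ ih
    rw [SimpleGraph.fromEdgeSet_adj] at huv
    obtain ⟨⟨t, ht, hte⟩, -⟩ := huv
    have hmem : edgeVec G t ∈ Submodule.span ℤ (Set.range fun e : T => edgeVec G e) :=
      Submodule.subset_span ⟨⟨t, ht⟩, rfl⟩
    rcases edgeVec_eq_or G hte with h | h
    · rwa [h] at hmem
    · rw [h] at hmem
      simpa using neg_mem hmem

theorem sum_edgeVec [Fintype V] (e : G.edgeSet) : ∑ v, edgeVec G e v = 0 := by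
  simp [edgeVec]

theorem edgeVec_mul_edgeVec_eq_zero {e e' : G.edgeSet} {v w : V} (hvw : v ≠ w)
    (h : (e : Sym2 V) = s(v, w)) (hne : e' ≠ e) : edgeVec G e' v * edgeVec G e' w = 0 := by
  by_contra h0
  have hmem : ∀ x, edgeVec G e' x ≠ 0 → x ∈ (e' : Sym2 V) := by
    intro x hx
    rw [← mk_out_edge G e', Sym2.mem_iff]
    by_contra! hcon
    exact hx (by simp [edgeVec, hcon.1, hcon.2])
  refine hne (Subtype.ext ?_)
  rw [h, ← Sym2.mem_and_mem_iff hvw]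
  exact ⟨hmem v (left_ne_zero_of_mul h0), hmem w (right_ne_zero_of_mul h0)⟩

/-- The incidence vectors restricted to the vertices other than the root `ρ`. -/
noncomputable def reducedEdgeVec (ρ : V) (R : Type*) [Ring R] (e : G.edgeSet) : {v // v ≠ ρ} → R :=
  fun v => (edgeVec G e v : R)

variable [Fintype V] [Fintype G.edgeSet] (ρ : V)

theorem det_indicator_of_connected (T : Finset G.edgeSet)
    (hT : (edgeSubgraph G T).Connected) (hcard : T.card + 1 = Fintype.card V) :
    (weightedGram (reducedEdgeVec G ρ ℤ) fun e => if e ∈ T then 1 else 0).det = 1 := by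
  classical
  rw [weightedGram_indicator_eq]
  have hex : ∀ w : {v // v ≠ ρ}, ∃ c : T → ℤ,
      ∑ e, c e • edgeVec G e = Pi.single (w : V) 1 - Pi.single ρ 1 := fun w =>
    (Submodule.mem_span_range_iff_exists_fun ℤ).mp
      (single_sub_single_mem_span G T (hT.preconnected w ρ))
  choose c hc using hex
  -- Writing each `δ_w - δ_ρ` in the edge vectors and dropping the coordinate `ρ` gives an integral
  -- right inverse of the incidence matrix.
  refine det_mul_transpose_eq_one_of_mul_eq_one ?_ _ (of fun e w => c w e) ?_
  · rw [Fintype.card_coe, Fintype.card_subtype_compl, Fintype.card_subtype_eq]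
    omega
  · ext v w
    have := congrFun (hc w) v
    simp only [Finset.sum_apply, Pi.smul_apply, Pi.sub_apply, smul_eq_mul, Pi.single_apply,
      if_neg v.2, sub_zero] at this
    rw [Matrix.mul_apply, one_apply]
    simp only [of_apply, reducedEdgeVec, Int.cast_id, mul_comm, this, Subtype.ext_iff]

theorem det_indicator_of_not_connected (T : Finset G.edgeSet)
    (hT : ¬ (edgeSubgraph G T).Connected) :
    (weightedGram (reducedEdgeVec G ρ ℤ) fun e => if e ∈ T then 1 else 0).det = 0 := by
  classical
  have hw : ∃ w, ¬ (edgeSubgraph G T).Reachable ρ w := by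
    by_contra! hcon
    exact hT ((SimpleGraph.connected_iff_exists_forall_reachable _).mpr ⟨ρ, hcon⟩)
  obtain ⟨w, hw⟩ := hw
  -- The indicator of the vertices not reachable from `ρ` is constant along the edges of `T` and
  -- vanishes at `ρ`, so it gives a nonzero kernel vector.
  set y : V → ℤ := fun v => if (edgeSubgraph G T).Reachable ρ v then 0 else 1 with hy
  have hwρ : w ≠ ρ := by
    rintro rfl
    exact hw (SimpleGraph.Reachable.refl _)
  refine exists_mulVec_eq_zero_iff.mp ⟨fun v : {v // v ≠ ρ} => y v, fun h => ?_, ?_⟩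
  · have := congrFun h ⟨w, hwρ⟩
    simp [hy, hw] at this
  · rw [weightedGram_mulVec]
    refine sum_eq_zero fun e _ => ?_
    by_cases he : e ∈ T
    · have hadj : (edgeSubgraph G T).Adj (Quot.out (e : Sym2 V)).1 (Quot.out (e : Sym2 V)).2 := by
        rw [← SimpleGraph.mem_edgeSet, edgeSet_edgeSubgraph]
        exact ⟨e, he, (mk_out_edge G e).symm⟩
      have hyeq : y (Quot.out (e : Sym2 V)).1 = y (Quot.out (e : Sym2 V)).2 := by
        have : (edgeSubgraph G T).Reachable ρ (Quot.out (e : Sym2 V)).1 ↔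
            (edgeSubgraph G T).Reachable ρ (Quot.out (e : Sym2 V)).2 :=
          ⟨fun h => h.trans hadj.reachable, fun h => h.trans hadj.symm.reachable⟩
        simp only [hy, this]
      have hyρ : y ρ = 0 := by simp [hy]
      have hsum : reducedEdgeVec G ρ ℤ e ⬝ᵥ (fun v : {v // v ≠ ρ} => y v) = edgeVec G e ⬝ᵥ y := by
        simp only [dotProduct, reducedEdgeVec, Int.cast_id]
        rw [← Fintype.sum_subtype_add_sum_subtype (· ≠ ρ) fun v => edgeVec G e v * y v]
        rw [left_eq_add]
        refine sum_eq_zero fun v _ => ?_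
        rw [not_not.mp v.2, hyρ, mul_zero]
      rw [hsum, edgeVec, sub_dotProduct]
      simp [hyeq]
    · simp [he]

open Classical in
/-- The weighted **matrix-tree theorem**. -/
theorem det_weightedGram_reducedEdgeVec (x : G.edgeSet → ℝ) :
    (weightedGram (reducedEdgeVec G ρ ℝ) x).det = eval x (kirchhoff G) := by
  have hcard : Fintype.card {v // v ≠ ρ} + 1 = Fintype.card V := by
    rw [Fintype.card_subtype_compl, Fintype.card_subtype_eq]
    have := Fintype.card_pos_iff.mpr ⟨ρ⟩
    omega
  have hcast : ∀ T : Finset G.edgeSet,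
      (weightedGram (reducedEdgeVec G ρ ℝ) fun e => if e ∈ T then 1 else 0).det =
        (((weightedGram (reducedEdgeVec G ρ ℤ) fun e => if e ∈ T then 1 else 0).det : ℤ) : ℝ) := by
    intro T
    rw [← eq_intCast (Int.castRingHom ℝ), RingHom.map_det, weightedGram_map]
    congr 2
    ext e
    simp [apply_ite]
  rw [det_weightedGram, kirchhoff, map_sum, sum_filter]
  rw [← sum_subset (subset_univ (powersetCard (Fintype.card {v // v ≠ ρ}) univ))]
  · refine sum_congr rfl fun T hT => ?_
    rw [mem_powersetCard_univ] at hT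
    rw [hcast, map_prod]
    split_ifs with h
    · rw [isSpanningTree_iff] at h
      rw [det_indicator_of_connected G ρ T h.1 h.2]
      simp
    · rw [det_indicator_of_not_connected G ρ T fun hc =>
        h ((isSpanningTree_iff G T).mpr ⟨hc, by rw [hT, hcard]⟩)]
      simp
  · intro T _ hT
    rw [if_neg]
    intro h
    rw [isSpanningTree_iff] at h
    rw [mem_powersetCard_univ] at hT
    omega

/-- The reduced weighted Laplacian determines the weights. -/
theorem eq_zero_of_weightedGram_reducedEdgeVec_eq_zero {u : G.edgeSet → ℝ}
    (h : weightedGram (reducedEdgeVec G ρ ℝ) u = 0) : u = 0 := by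
  have h0 : ∀ v w, v ≠ ρ → w ≠ ρ → ∑ e, u e * (edgeVec G e v * edgeVec G e w) = 0 := by
    intro v w hv hw
    have := congrFun (congrFun h ⟨v, hv⟩) ⟨w, hw⟩
    rwa [weightedGram_apply] at this
  -- Incidence vectors have coordinate sum zero, so Laplacian entries in the column of the root
  -- follow from the reduced ones.
  have hρ : ∀ e, (edgeVec G e ρ : ℝ) = -∑ w : {w // w ≠ ρ}, (edgeVec G e w : ℝ) := by
    intro e
    have hs := sum_edgeVec G e
    rw [← Fintype.sum_subtype_add_sum_subtype (· ≠ ρ) fun v => edgeVec G e v] at hs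
    have hr : ∑ v : {v // ¬ v ≠ ρ}, edgeVec G e v = edgeVec G e ρ := by
      rw [Fintype.sum_eq_single ⟨ρ, by simp⟩]
      intro v hv
      exact absurd (Subtype.ext (not_not.mp v.2)) hv
    rw [hr] at hs
    have : edgeVec G e ρ = -∑ w : {w // w ≠ ρ}, edgeVec G e w := by linarith
    exact_mod_cast this
  have h1 : ∀ v w, v ≠ ρ → ∑ e, u e * (edgeVec G e v * edgeVec G e w) = 0 := by
    intro v w hv
    by_cases hw : w = ρ
    · rw [hw]
      simp only [hρ, mul_neg, Finset.mul_sum, Finset.sum_neg_distrib]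
      rw [Finset.sum_comm]
      rw [Finset.sum_eq_zero fun (w : {w // w ≠ ρ}) _ => h0 v w hv w.2, neg_zero]
    · exact h0 v w hv hw
  funext e
  obtain ⟨v, w, hvw⟩ : ∃ v w, (e : Sym2 V) = s(v, w) := ⟨_, _, (mk_out_edge G e).symm⟩
  have hne : v ≠ w := by
    have := e.2
    rw [hvw, SimpleGraph.mem_edgeSet] at this
    exact this.ne
  have h2 : ∑ e', u e' * (edgeVec G e' v * edgeVec G e' w) = 0 := by
    by_cases hv : v = ρ
    · simp only [mul_comm (edgeVec G _ v : ℝ)]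
      exact h1 w v (hv ▸ hne.symm)
    · exact h1 v w hv
  -- In a simple graph only `e` joins `v` and `w`, so this off-diagonal entry is `-u e`.
  rw [Fintype.sum_eq_single e fun e' he' => by
    rw [← Int.cast_mul, edgeVec_mul_edgeVec_eq_zero G hne hvw he', Int.cast_zero, mul_zero]] at h2
  rcases edgeVec_eq_or G hvw with h | h <;> simpa [h, hne, hne.symm] using h2

omit [DecidableEq V] [Fintype V] in
theorem eval_kirchhoff_pos (hG : G.Connected) {a : G.edgeSet → ℝ} (ha : ∀ e, 0 < a e) :
    0 < eval a (kirchhoff G) := by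
  classical
  obtain ⟨T, hT⟩ := exists_isSpanningTree G hG
  rw [kirchhoff, map_sum]
  refine sum_pos (fun T _ => ?_) ⟨T, by simpa using hT⟩
  simpa using prod_pos fun e _ => ha e

omit [DecidableEq V] in
theorem kirchhoff_isHomogeneous {r : ℕ} (hV : Fintype.card V = r + 1) :
    (kirchhoff G).IsHomogeneous r := by
  classical
  refine IsHomogeneous.sum _ _ _ fun T hT => ?_
  have hT' := ((isSpanningTree_iff G T).mp (by simpa using hT)).2
  have : T.card = r := by omega
  have h := IsHomogeneous.prod T (fun e => (X e : MvPolynomial G.edgeSet ℝ)) (fun _ => 1)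
    fun e _ => isHomogeneous_X ℝ e
  simpa [this] using h

/-- A positive combination of rank-one squares is positive semidefinite. Its determinant is a sum
over spanning trees, nonzero as `G` is connected. -/
theorem posDef_weightedGram_reducedEdgeVec (hG : G.Connected) {a : G.edgeSet → ℝ}
    (ha : ∀ e, 0 < a e) : (weightedGram (reducedEdgeVec G ρ ℝ) a).PosDef := by
  have hpsd : (weightedGram (reducedEdgeVec G ρ ℝ) a).PosSemidef :=
    posSemidef_sum _ fun e _ =>
      (by simpa using posSemidef_vecMulVec_self_star (reducedEdgeVec G ρ ℝ e) :
        (vecMulVec (reducedEdgeVec G ρ ℝ e) (reducedEdgeVec G ρ ℝ e)).PosSemidef).smul (ha e).le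
  rw [hpsd.posDef_iff_det_ne_zero, det_weightedGram_reducedEdgeVec]
  exact (eval_kirchhoff_pos G hG ha).ne'

omit [Fintype V] in
theorem isHermitian_weightedGram_reducedEdgeVec (u : G.edgeSet → ℝ) :
    (weightedGram (reducedEdgeVec G ρ ℝ) u).IsHermitian := by
  ext v w
  simp [weightedGram_apply, mul_comm]

end Laplacian

/-! ### The Hodge–Riemann form of a homogeneous polynomial. -/

section HodgeRiemann

variable {σ : Type*} [Fintype σ] {F : MvPolynomial σ ℝ} {r : ℕ}

theorem linearElement_surjective (F : MvPolynomial σ ℝ) :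
    Function.Surjective (linearElement F) := by
  rintro ⟨_, P, hP, rfl⟩
  have hP' : P.IsHomogeneous 1 := hP
  have hC : ∀ i, pderiv i P = C (coeff 0 (pderiv i P)) := fun i => by
    have h : (pderiv i P).IsHomogeneous 0 := hP'.pderiv
    rwa [← totalDegree_zero_iff_isHomogeneous, totalDegree_eq_zero_iff_eq_C] at h
  refine ⟨fun i => coeff 0 (pderiv i P), Subtype.ext ?_⟩
  change Ideal.Quotient.mk (annIdeal F) _ = Ideal.Quotient.mk (annIdeal F) P
  congr 1
  have := hP'.sum_X_mul_pderiv
  rw [one_smul] at this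
  refine Eq.trans (Finset.sum_congr rfl fun i _ => ?_) this
  rw [← hC, mul_comm]

/-- The linear parametrization of `R_F^1` by coefficient vectors. -/
noncomputable def linearElementMap (F : MvPolynomial σ ℝ) : (σ → ℝ) →ₗ[ℝ] gradedPiece F 1 where
  toFun := linearElement F
  map_add' u w := Subtype.ext <| by
    change Ideal.Quotient.mk (annIdeal F) _ =
      Ideal.Quotient.mk (annIdeal F) _ + Ideal.Quotient.mk (annIdeal F) _
    rw [← map_add]
    simp [add_mul, Finset.sum_add_distrib]
  map_smul' c u := Subtype.ext <| by
    change Ideal.Quotient.mk (annIdeal F) _ =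
      Ideal.Quotient.mk (annIdeal F) (c • ∑ i, C (u i) * X i)
    simp [Finset.smul_sum, smul_eq_C_mul, mul_assoc]

/-- The operators commute, so `L_a ^ (r - 2)` may act last, on a form of degree `r - 2`, where it
evaluates at `a` up to the factorial. -/
theorem hodgeRiemannForm_linearElement (hF : F.IsHomogeneous r) (hr : 2 ≤ r) (a u w : σ → ℝ) :
    hodgeRiemannForm F r (linearElement F a) (linearElement F u) (linearElement F w) =
      (r - 2).factorial *
        eval a (diffOp (∑ i, C (u i) * X i) (diffOp (∑ i, C (w i) * X i) F)) := by
  have h : hodgeRiemannForm F r (linearElement F a) (linearElement F u) (linearElement F w) =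
      bracket F (Ideal.Quotient.mk (annIdeal F)
        ((∑ i, C (a i) * X i) ^ (r - 2) * ((∑ i, C (u i) * X i) * ∑ i, C (w i) * X i))) := by
    rw [mul_left_comm, ← mul_assoc, map_mul (Ideal.Quotient.mk _), map_mul (Ideal.Quotient.mk _),
      map_pow (Ideal.Quotient.mk _)]
    rfl
  obtain ⟨k, rfl⟩ := Nat.exists_eq_add_of_le' hr
  rw [h, Nat.add_sub_cancel, bracket, LinearMap.comp_apply, applyTo_mk, map_mul, map_mul,
    Module.End.mul_apply, Module.End.mul_apply, diffOp_C_mul_X_sum_pow a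
      (diffOp_C_mul_X_sum_isHomogeneous u (diffOp_C_mul_X_sum_isHomogeneous w hF))]
  exact coeff_zero_C _

omit [Fintype σ] in
theorem hodgeRiemannForm_comm (L ξ η : gradedPiece F 1) :
    hodgeRiemannForm F r L ξ η = hodgeRiemannForm F r L η ξ := by
  change bracket F (_ * _ * _) = bracket F (_ * _ * _)
  congr 1
  ring

omit [Fintype σ] in
theorem hodgeRiemannForm_eq_zero_of_pow_mul_eq_zero (hr : 2 ≤ r) {L ξ : gradedPiece F 1}
    (h : (L : GorensteinAlgebra F) ^ (r - 1) * (ξ : GorensteinAlgebra F) = 0) :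
    hodgeRiemannForm F r L L ξ = 0 := by
  obtain ⟨k, rfl⟩ := Nat.exists_eq_add_of_le' hr
  change bracket F ((L : GorensteinAlgebra F) * (L : GorensteinAlgebra F) ^ k * ξ) = 0
  rw [← pow_succ']
  exact (congrArg (bracket F) h).trans (map_zero _)

-- In degree `r` the polynomial `P(∂)F` is a constant, so a zero bracket already puts `P` in
-- `annIdeal F`. Surjectivity onto a line only needs one nonzero value.
omit [Fintype σ] in
theorem bracket_bijective (hF : F.IsHomogeneous r)
    (hne : ∃ P : MvPolynomial σ ℝ, P.IsHomogeneous r ∧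
      bracket F (Ideal.Quotient.mk (annIdeal F) P) ≠ 0) :
    Function.Bijective ((bracket F).domRestrict (gradedPiece F r)) := by
  constructor
  · rw [← LinearMap.ker_eq_bot, LinearMap.ker_eq_bot']
    rintro ⟨ξ, hξ⟩ h
    have h0 : bracket F ξ = 0 := h
    have happ := C_bracket hF hξ
    rw [h0, C_0] at happ
    obtain ⟨P, hP, rfl⟩ := hξ
    exact Subtype.ext (Ideal.Quotient.eq_zero_iff_mem.mpr happ.symm)
  · obtain ⟨P, hP, h⟩ := hne
    refine LinearMap.surjective_of_ne_zero fun h0 => h ?_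
    exact congrArg (fun f => f ⟨_, P, hP, rfl⟩) h0

end HodgeRiemann

/-! ### Lorentzian signature for the Kirchhoff polynomial. -/

section Kirchhoff

universe u

variable {V : Type u} [Fintype V] (G : SimpleGraph V) [Fintype G.edgeSet]

theorem exists_eval_line_kirchhoff (hG : G.Connected) {a : G.edgeSet → ℝ} (ha : ∀ e, 0 < a e)
    {u : G.edgeSet → ℝ} (hu : u ≠ 0) :
    ∃ (ι : Type u) (_ : Fintype ι) (μ : ι → ℝ), μ ≠ 0 ∧
      ∀ t : ℝ, eval (a + t • u) (kirchhoff G) = eval a (kirchhoff G) * ∏ i, (1 + t * μ i) := by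
  classical
  obtain ⟨ρ⟩ := hG.nonempty
  obtain ⟨μ, h, hμ⟩ := (posDef_weightedGram_reducedEdgeVec G ρ hG ha).exists_det_add_smul_eq
    (isHermitian_weightedGram_reducedEdgeVec G ρ u)
  refine ⟨_, inferInstance, μ, fun h0 => hu ?_, fun t => ?_⟩
  · exact eq_zero_of_weightedGram_reducedEdgeVec_eq_zero G ρ (hμ h0)
  · have := h t
    rwa [← weightedGram_smul, ← weightedGram_add, det_weightedGram_reducedEdgeVec,
      det_weightedGram_reducedEdgeVec] at this

theorem hodgeRiemannForm_kirchhoff_self_pos (hG : G.Connected) {r : ℕ} (hr : 2 ≤ r)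
    (hV : Fintype.card V = r + 1) {a : G.edgeSet → ℝ} (ha : ∀ e, 0 < a e) :
    0 < hodgeRiemannForm (kirchhoff G) r (linearElement (kirchhoff G) a)
      (linearElement (kirchhoff G) a) (linearElement (kirchhoff G) a) := by
  have hF := kirchhoff_isHomogeneous G hV
  rw [hodgeRiemannForm_linearElement hF hr]
  obtain ⟨k, rfl⟩ := Nat.exists_eq_add_of_le' hr
  rw [eval_diffOp_C_mul_X_sum_self a (diffOp_C_mul_X_sum_isHomogeneous a hF),
    eval_diffOp_C_mul_X_sum_self a hF]
  have := eval_kirchhoff_pos G hG ha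
  positivity

theorem hodgeRiemannForm_kirchhoff_neg (hG : G.Connected) {r : ℕ} (hr : 2 ≤ r)
    (hV : Fintype.card V = r + 1) {a u : G.edgeSet → ℝ} (ha : ∀ e, 0 < a e) (hu : u ≠ 0)
    (h : hodgeRiemannForm (kirchhoff G) r (linearElement (kirchhoff G) a)
      (linearElement (kirchhoff G) a) (linearElement (kirchhoff G) u) = 0) :
    hodgeRiemannForm (kirchhoff G) r (linearElement (kirchhoff G) a)
      (linearElement (kirchhoff G) u) (linearElement (kirchhoff G) u) < 0 := by
  have hF := kirchhoff_isHomogeneous G hV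
  obtain ⟨ι, _, μ, hμ, hline⟩ := exists_eval_line_kirchhoff G hG ha hu
  obtain ⟨h1, h2⟩ := eval_diffOp_of_eval_line_eq_prod hline
  rw [hodgeRiemannForm_linearElement hF hr] at h ⊢
  have hpos := eval_kirchhoff_pos G hG ha
  have hfac : (0 : ℝ) < (r - 2).factorial := by positivity
  obtain ⟨k, rfl⟩ := Nat.exists_eq_add_of_le' hr
  -- The derivative along `u` has degree `k + 1 = r - 1`, so Euler's identity makes `h` a nonzero
  -- multiple of `∑ μ i`.
  rw [eval_diffOp_C_mul_X_sum_self a (diffOp_C_mul_X_sum_isHomogeneous u hF), h1] at h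
  have hsum : ∑ i, μ i = 0 := by
    have hk : ((k + 1 : ℕ) : ℝ) ≠ 0 := by positivity
    exact ((mul_eq_zero.mp ((mul_eq_zero.mp ((mul_eq_zero.mp h).resolve_left hfac.ne')).resolve_left
      hk)).resolve_left hpos.ne')
  have hsq : 0 < ∑ i, μ i ^ 2 := by
    obtain ⟨i, hi⟩ := Function.ne_iff.mp hμ
    exact Finset.sum_pos' (fun i _ => sq_nonneg _) ⟨i, Finset.mem_univ i, by
      have : μ i ≠ 0 := hi
      positivity⟩
  rw [h2, hsum]
  refine mul_neg_of_pos_of_neg hfac (mul_neg_of_pos_of_neg hpos ?_)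
  linarith

end Kirchhoff

theorem theorem5p10 {V : Type*} [Fintype V] (G : SimpleGraph V) [Fintype G.edgeSet]
    (hG : G.Connected) (r n : ℕ) (hr : 3 ≤ r + 1) (hn : 3 ≤ n)
    (hV : Fintype.card V = r + 1) (hE : Fintype.card G.edgeSet = n)
    (a : G.edgeSet → ℝ) (ha : ∀ e, 0 < a e) :
    -- `[-] : R^r → ℝ` is an isomorphism
    Function.Bijective ((bracket (kirchhoff G)).domRestrict (gradedPiece (kirchhoff G) r)) ∧
    -- the Hodge–Riemann form `Q` on `R^1` with respect to `L_a` is nondegenerate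
    (hodgeRiemannForm (kirchhoff G) r (linearElement (kirchhoff G) a)).Nondegenerate ∧
    -- `R^1` has dimension `n`, and the Gram matrix of `Q` in any basis of `R^1` is symmetric
    -- with `n - 1` negative eigenvalues and one positive eigenvalue
    Module.finrank ℝ (gradedPiece (kirchhoff G) 1) = n ∧
    (∀ b : Module.Basis (Fin n) ℝ (gradedPiece (kirchhoff G) 1),
      ∃ hQ : (LinearMap.BilinForm.toMatrix b
          (hodgeRiemannForm (kirchhoff G) r (linearElement (kirchhoff G) a))).IsHermitian,
        Fintype.card {i // hQ.eigenvalues i < 0} = n - 1 ∧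
        Fintype.card {i // 0 < hQ.eigenvalues i} = 1) ∧
    -- the Hodge–Riemann relation holds in degree one
    HodgeRiemannRelation (kirchhoff G) r (linearElement (kirchhoff G) a) := by
  have hr2 : 2 ≤ r := by omega
  have hF := kirchhoff_isHomogeneous G hV
  set F := kirchhoff G
  set L := linearElement F a
  have hpos : 0 < hodgeRiemannForm F r L L L := hodgeRiemannForm_kirchhoff_self_pos G hG hr2 hV ha
  -- A nonzero `u` with zero class would be orthogonal to `L`, and negativity would then read `0 <
  -- 0`.
  have hinj : Function.Injective (linearElementMap F) := by
    rw [← LinearMap.ker_eq_bot, LinearMap.ker_eq_bot']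
    intro u hu
    by_contra hne
    have hu' : linearElement F u = 0 := hu
    have := hodgeRiemannForm_kirchhoff_neg G hG hr2 hV ha hne
    rw [show linearElement (kirchhoff G) u = 0 from hu'] at this
    simp at this
  have hneg : ∀ ξ : gradedPiece F 1, ξ ≠ 0 → hodgeRiemannForm F r L L ξ = 0 →
      hodgeRiemannForm F r L ξ ξ < 0 := by
    intro ξ hξ h
    obtain ⟨u, rfl⟩ := linearElement_surjective F ξ
    refine hodgeRiemannForm_kirchhoff_neg G hG hr2 hV ha ?_ h
    rintro rfl
    exact hξ (map_zero (linearElementMap F))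
  refine ⟨bracket_bijective hF ⟨(∑ e, C (a e) * X e) ^ r, ?_, ?_⟩, ?_, ?_, fun b => ?_,
    fun ξ h hξ => hneg ξ hξ (hodgeRiemannForm_eq_zero_of_pow_mul_eq_zero hr2 h)⟩
  · have h1 : (∑ e, C (a e) * X e : MvPolynomial G.edgeSet ℝ).IsHomogeneous 1 :=
      IsHomogeneous.sum _ _ _ fun e _ => (isHomogeneous_X ℝ e).C_mul (a e)
    simpa using h1.pow r
  -- The class of `L_a ^ r` witnesses that the bracket is nonzero: its value is `r! F(a)`.
  · rw [bracket, LinearMap.comp_apply, applyTo_mk, diffOp_C_mul_X_sum_pow a hF]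
    refine ne_of_eq_of_ne (coeff_zero_C _) (mul_ne_zero ?_ (eval_kirchhoff_pos G hG ha).ne')
    exact_mod_cast r.factorial_ne_zero
  · have hsep : ∀ ξ, (∀ η, hodgeRiemannForm F r L ξ η = 0) → ξ = 0 := by
      intro ξ h
      by_contra hξ
      exact (hneg ξ hξ (by rw [hodgeRiemannForm_comm, h])).ne (h ξ)
    exact ⟨hsep, fun η h => hsep η fun ξ => by rw [hodgeRiemannForm_comm, h]⟩
  · rw [← (LinearEquiv.ofBijective (linearElementMap F)
      ⟨hinj, linearElement_surjective F⟩).finrank_eq, Module.finrank_fintype_fun_eq_card, hE]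
  · have hQ : (LinearMap.BilinForm.toMatrix b (hodgeRiemannForm F r L)).IsHermitian := by
      ext i j
      simp [LinearMap.BilinForm.toMatrix_apply, hodgeRiemannForm_comm L (b i)]
    have hev : ∀ ξ η, b.repr ξ ⬝ᵥ (LinearMap.BilinForm.toMatrix b (hodgeRiemannForm F r L)).mulVec
        (b.repr η) = hodgeRiemannForm F r L ξ η := fun ξ η =>
      (LinearMap.BilinForm.apply_eq_dotProduct_toMatrix_mulVec b _ ξ η).symm
    have h := hQ.card_eigenvalues_of_lorentzian (b.repr L) (by rwa [hev]) (by
      intro x hx h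
      obtain ⟨ξ, rfl⟩ := b.equivFun.surjective x
      simp only [Module.Basis.equivFun_apply] at h hx ⊢
      rw [hev] at h ⊢
      refine hneg ξ ?_ h
      rintro rfl
      exact hx (by simp))
    rw [Fintype.card_fin] at h
    exact ⟨hQ, h⟩
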